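/- Let $X$ be a reflexive real Banach space, $(\Omega,\beta,\mu)$ a finite measure space, and $\tau:\Omega\to\Omega$ a measure-preserving endomorphism. Put $Tf=f\circ\tau$ and $S_nf=\frac1n\sum_{i=0}^{n-1}T^if$ for $n\ge 1$. Let $(F_n)$ be a decreasing sequence of sub-$\sigma$-algebras of $\beta$, and let $E(\cdot\,|F_n)$ be the conditional expectation of $X$-valued Bochner integrable functions. Write $\|h\|_p=\left(\int_\Omega\|h\|^p\,d\mu\right)^{1/p}\in[0,\infty]$. For real $m\ge 0$ let $L(\log^+L)^m$ be the class of (strongly) measurable functions $h$ on $\Omega$ with values in $X$, or in $[0,\infty]$, such that $\int_\Omega\|h\|\,[\log\max(1,\|h\|)]^m\,d\mu<\infty$ (the integrand being $\infty$ where $h=\infty$, and $0^0=1$). **Theorem 2.4 (Dominant inequality).** Let $f\in L_1(\Omega,X)$ be such that $\sup_{n\ge1}\|S_nf\|_X\in L_1$. 1. For every real $p>1$, $$\Big\|\sup_{n_1,n_2\ge 1}\|E(S_{n_1}f|F_{n_2})\|_X\Big\|_p\le\Big(\frac p{p-1}\Big)^2\|f\|_p .$$ 2. For every real $m\ge0$,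 if $f\in L(\log^+L)^{m+2}$, then $$\sup_{n_1,n_2\ge 1}\|E(S_{n_1}f|F_{n_2})\|_X\in L(\log^+L)^m .$$ -/

import Mathlib

open MeasureTheory
open scoped ENNReal

noncomputable section

namespace MartingaleErgodic

/-- A real normed space is reflexive: the canonical embedding into the bidual is onto. -/
def IsReflexiveSpace (X : Type*) [NormedAddCommGroup X] [NormedSpace ℝ X] : Prop :=
  Function.Surjective (NormedSpace.inclusionInDoubleDual ℝ X)

/-- The linear operator `T f = f ∘ τ` generated by a transformation `τ`. -/
def koopman (X : Type*) [NormedAddCommGroup X] [NormedSpace ℝ X] {Ω : Type*} (τ : Ω → Ω) :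
    (Ω → X) →ₗ[ℝ] (Ω → X) where
  toFun f := f ∘ τ
  map_add' _ _ := rfl
  map_smul' _ _ := rfl

/-- The ergodic average `S_n f = (1/n) ∑_{i=0}^{n-1} T^i f` of a linear operator `T`
(it is meant for `n ≥ 1`). -/
def ergodicAverage {X Ω : Type*} [NormedAddCommGroup X] [NormedSpace ℝ X]
    (T : (Ω → X) →ₗ[ℝ] (Ω → X)) (n : ℕ) (f : Ω → X) : Ω → X :=
  (n : ℝ)⁻¹ • ∑ i ∈ Finset.range n, (T ^ i) f

/-- `sup_{n ≥ 1} ‖S_n f‖`, with values in `[0, ∞]`. -/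
def ergodicMaximal {X Ω : Type*} [NormedAddCommGroup X] [NormedSpace ℝ X]
    (T : (Ω → X) →ₗ[ℝ] (Ω → X)) (f : Ω → X) (ω : Ω) : ℝ≥0∞ :=
  ⨆ n : ℕ, ‖ergodicAverage T (n + 1) f ω‖ₑ

/-- `sup_{n₁ ≥ 1, n₂} ‖E(S_{n₁} f | F_{n₂})‖`, with values in `[0, ∞]`. -/
def martingaleErgodicMaximal {X Ω : Type*} [NormedAddCommGroup X] [NormedSpace ℝ X]
    [CompleteSpace X] {mΩ : MeasurableSpace Ω} (μ : Measure Ω) (F : ℕ → MeasurableSpace Ω)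
    (T : (Ω → X) →ₗ[ℝ] (Ω → X)) (f : Ω → X) (ω : Ω) : ℝ≥0∞ :=
  ⨆ (n₁ : ℕ) (n₂ : ℕ), ‖(μ[ergodicAverage T (n₁ + 1) f | F n₂]) ω‖ₑ

/-- The class `L (log⁺ L)^m`: the a.e. strongly measurable functions `g` such that
`∫ ‖g‖ (log max (1, ‖g‖))^m dμ < ∞`. The function may have values in a normed space or in
`[0, ∞]`. In the latter case the integrand is `∞` where `g = ∞`, so that for `m ≥ 0` the members
of the class are finite a.e. -/
def MemLLogL {ε Ω : Type*} [TopologicalSpace ε] [ContinuousENorm ε] {mΩ : MeasurableSpace Ω}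
    (g : Ω → ε) (m : ℝ) (μ : Measure Ω) : Prop :=
  AEStronglyMeasurable g μ ∧
    ∫⁻ ω, ‖g ω‖ₑ * (ENNReal.log (max 1 ‖g ω‖ₑ)).toENNReal ^ m ∂μ < ∞

end MartingaleErgodic

end

/-! The vector-valued problem reduces to two scalar maximal functions. Since `‖E(h|F)‖ ≤ E(‖h‖|F)`
and `‖S_n f‖ ≤ S_n ‖f‖`, the double supremum is a.e. at most `M = sup_k E(G|F_k)`, where `G = sup_n
S_n ‖f‖`. As `G` may fail to be integrable, `M` is built from `condLExp`, the conditional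
expectation of `[0, ∞]`-valued functions.

Both steps obey the same inequality `t μ{M > t} ≤ ∫_{M > t} u` (`WeakMaximal`): for the pair `‖f‖,
G` it is the maximal ergodic theorem, for `G, M` it is Doob's inequality. This inequality alone
gives the `L_p` bound with constant `p / (p - 1)` and costs one logarithm in the classes `L (log⁺
L)^m`. Using it twice squares the constant and costs two logarithms. -/

namespace MartingaleErgodic

open Set

variable {Ω : Type*}

/-! ### Maximal Birkhoff sums and ergodic averages -/

/-- The maximum of the Birkhoff sums of `h` of length at most `N`. -/
def birkhoffMax (τ : Ω → Ω) (h : Ω → ℝ) : ℕ → Ω → ℝ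
  | 0 => 0
  | N + 1 => fun ω => max 0 (h ω + birkhoffMax τ h N (τ ω))

theorem birkhoffMax_nonneg (τ : Ω → Ω) (h : Ω → ℝ) (N : ℕ) (ω : Ω) : 0 ≤ birkhoffMax τ h N ω := by
  cases N with
  | zero => exact le_rfl
  | succ N => exact le_max_left _ _

theorem birkhoffMax_le_succ (τ : Ω → Ω) (h : Ω → ℝ) (N : ℕ) :
    ∀ ω, birkhoffMax τ h N ω ≤ birkhoffMax τ h (N + 1) ω := by
  induction N with
  | zero => exact fun ω => le_max_left _ _
  | succ N ih => exact fun ω => max_le_max le_rfl (by gcongr; exact ih _)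

theorem birkhoffSum_le_birkhoffMax (τ : Ω → Ω) (h : Ω → ℝ) (N : ℕ) :
    ∀ ω, birkhoffSum τ h N ω ≤ birkhoffMax τ h N ω := by
  induction N with
  | zero => intro ω; simp [birkhoffMax]
  | succ N ih =>
    intro ω
    rw [birkhoffSum_succ']
    exact le_max_of_le_right (by gcongr; exact ih _)

theorem exists_birkhoffMax_eq (τ : Ω → Ω) (h : Ω → ℝ) (N : ℕ) :
    ∀ ω, ∃ n, birkhoffMax τ h N ω = birkhoffSum τ h n ω := by
  induction N with
  | zero => exact fun ω => ⟨0, by simp [birkhoffMax]⟩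
  | succ N ih =>
    intro ω
    rcases max_choice 0 (h ω + birkhoffMax τ h N (τ ω)) with h0 | h0
    · exact ⟨0, by simpa [birkhoffMax] using h0⟩
    · obtain ⟨n, hn⟩ := ih (τ ω)
      exact ⟨n + 1, by rw [birkhoffSum_succ', ← hn]; exact h0⟩

theorem koopman_pow_apply {X : Type*} [NormedAddCommGroup X] [NormedSpace ℝ X] (τ : Ω → Ω) (i : ℕ)
    (f : Ω → X) : (koopman X τ ^ i) f = f ∘ τ^[i] := by
  induction i with
  | zero => rfl
  | succ i ih =>
    rw [pow_succ', Module.End.mul_apply, ih, Function.iterate_succ]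
    rfl

/-- The bound by `v` is asked only along the orbit of `ω`, because it will be known only almost
everywhere. -/
theorem enorm_ergodicAverage_le {X : Type*} [NormedAddCommGroup X] [NormedSpace ℝ X] {τ : Ω → Ω}
    {f : Ω → X} {v : Ω → ℝ} {ω : Ω} (h : ∀ i, ‖f (τ^[i] ω)‖ ≤ v (τ^[i] ω)) (n : ℕ) :
    ‖ergodicAverage (koopman X τ) n f ω‖ₑ ≤ ENNReal.ofReal (birkhoffAverage ℝ τ v n ω) := by
  rw [← ofReal_norm]
  refine ENNReal.ofReal_le_ofReal ?_
  simp only [ergodicAverage, koopman_pow_apply, Pi.smul_apply, Finset.sum_apply, birkhoffAverage,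
    birkhoffSum, Function.comp_apply, norm_smul, norm_inv, RCLike.norm_natCast, smul_eq_mul]
  gcongr
  exact (norm_sum_le _ _).trans (Finset.sum_le_sum fun i _ => h i)

variable [mΩ : MeasurableSpace Ω] {μ : Measure Ω}

/-- `M` satisfies the maximal inequality of weak type with respect to `u`. -/
def WeakMaximal (μ : Measure Ω) (u M : Ω → ℝ≥0∞) : Prop :=
  ∀ t : ℝ, 0 < t → ENNReal.ofReal t * μ {ω | ENNReal.ofReal t < M ω} ≤
    ∫⁻ ω in {ω | ENNReal.ofReal t < M ω}, u ω ∂μ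

theorem mul_measure_iUnion_le_setLIntegral {u : Ω → ℝ≥0∞} {c : ℝ≥0∞} {A : ℕ → Set Ω}
    (hA : Monotone A) (h : ∀ n, c * μ (A n) ≤ ∫⁻ ω in A n, u ω ∂μ) :
    c * μ (⋃ n, A n) ≤ ∫⁻ ω in ⋃ n, A n, u ω ∂μ := by
  rw [hA.measure_iUnion, ENNReal.mul_iSup]
  exact iSup_le fun n => (h n).trans (lintegral_mono_set (subset_iUnion A n))

/-! ### Doob's inequality for decreasing σ-algebras -/

/-- Split according to the largest index `k` with `c < E(u|F_k)`: the failure at later indices is an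
event of smaller σ-algebras, hence of `F k`, so the defining property of `E(u|F_k)` applies on each
piece. The set `C` carries that failure through the induction. -/
theorem mul_measure_inter_exists_lt_condLExp_le [IsFiniteMeasure μ] {F : ℕ → MeasurableSpace Ω}
    (hF_le : ∀ n, F n ≤ mΩ) (hF_anti : Antitone F) (u : Ω → ℝ≥0∞) (c : ℝ≥0∞) (N : ℕ) :
    ∀ C : Set Ω, MeasurableSet[F N] C →
      c * μ (C ∩ {ω | ∃ k < N + 1, c < (μ⁻[u|F k]) ω}) ≤
        ∫⁻ ω in C ∩ {ω | ∃ k < N + 1, c < (μ⁻[u|F k]) ω}, u ω ∂μ := by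
  have hD (k : ℕ) : MeasurableSet[F k] {ω | c < (μ⁻[u|F k]) ω} :=
    measurable_condLExp (F k) μ u measurableSet_Ioi
  have key (k : ℕ) (C : Set Ω) (hC : MeasurableSet[F k] C) :
      c * μ (C ∩ {ω | c < (μ⁻[u|F k]) ω}) ≤ ∫⁻ ω in C ∩ {ω | c < (μ⁻[u|F k]) ω}, u ω ∂μ := by
    have hs : MeasurableSet[F k] (C ∩ {ω | c < (μ⁻[u|F k]) ω}) := hC.inter (hD k)
    rw [← setLIntegral_condLExp (hF_le k) μ u hs, ← setLIntegral_const]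
    exact setLIntegral_mono' (hF_le k _ hs) fun ω hω => hω.2.le
  induction N with
  | zero => intro C hC; simpa using key 0 C hC
  | succ N ih =>
    intro C hC
    set D : Set Ω := {ω | c < (μ⁻[u|F (N + 1)]) ω} with hDdef
    have hCD : MeasurableSet[F (N + 1)] (C \ D) := hC.diff (hD _)
    have hCN : MeasurableSet[F N] (C \ D) := hF_anti (Nat.le_succ N) _ hCD
    have hset : C ∩ {ω | ∃ k < N + 1 + 1, c < (μ⁻[u|F k]) ω} =
        (C ∩ D) ∪ ((C \ D) ∩ {ω | ∃ k < N + 1, c < (μ⁻[u|F k]) ω}) := by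
      ext ω
      simp only [Nat.lt_succ_iff_lt_or_eq (n := N + 1), mem_inter_iff, mem_ofPred_eq, mem_union,
        mem_sdiff, hDdef, or_and_right, exists_or, exists_eq_left]
      by_cases h : c < (μ⁻[u|F (N + 1)]) ω <;> by_cases h' : ω ∈ C <;> simp [h, h']
    have hmeas : MeasurableSet ((C \ D) ∩ {ω | ∃ k < N + 1, c < (μ⁻[u|F k]) ω}) := by
      refine (hF_le _ _ hCN).inter ?_
      simp only [ofPred_exists, ofPred_and]
      exact .iUnion fun k => (MeasurableSet.const _).inter (hF_le k _ (hD k))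
    have hdisj : Disjoint (C ∩ D) ((C \ D) ∩ {ω | ∃ k < N + 1, c < (μ⁻[u|F k]) ω}) :=
      disjoint_left.2 fun ω h1 h2 => h2.1.2 h1.2
    rw [hset, measure_union hdisj hmeas, lintegral_union hmeas hdisj, mul_add]
    exact add_le_add (key _ C hC) (ih _ hCN)

theorem weakMaximal_iSup_condLExp [IsFiniteMeasure μ] {F : ℕ → MeasurableSpace Ω}
    (hF_le : ∀ n, F n ≤ mΩ) (hF_anti : Antitone F) (u : Ω → ℝ≥0∞) :
    WeakMaximal μ u fun ω => ⨆ k, (μ⁻[u|F k]) ω := by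
  intro t _
  have hset : {ω | ENNReal.ofReal t < ⨆ k, (μ⁻[u|F k]) ω} =
      ⋃ N : ℕ, {ω | ∃ k < N + 1, ENNReal.ofReal t < (μ⁻[u|F k]) ω} := by
    ext ω
    simp only [lt_iSup_iff, mem_ofPred_eq, mem_iUnion]
    exact ⟨fun ⟨k, hk⟩ => ⟨k, k, k.lt_succ_self, hk⟩, fun ⟨_, k, _, hk⟩ => ⟨k, hk⟩⟩
  rw [hset]
  refine mul_measure_iUnion_le_setLIntegral ?_ fun N => ?_
  · rintro N N' h ω ⟨k, hk, hk'⟩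
    exact ⟨k, by omega, hk'⟩
  · simpa using mul_measure_inter_exists_lt_condLExp_le hF_le hF_anti u (ENNReal.ofReal t) N univ
      MeasurableSet.univ

/-! ### The maximal ergodic theorem -/

theorem integrable_birkhoffMax {τ : Ω → Ω} (hτ : MeasurePreserving τ μ μ) {h : Ω → ℝ}
    (hh : Integrable h μ) (N : ℕ) : Integrable (birkhoffMax τ h N) μ := by
  induction N with
  | zero => exact integrable_zero _ _ _
  | succ N ih =>
    exact (integrable_zero Ω ℝ μ).sup (hh.add (hτ.integrable_comp_of_integrable ih))

theorem measurable_birkhoffMax {τ : Ω → Ω} (hτ : Measurable τ) {h : Ω → ℝ}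
    (hh : Measurable h) (N : ℕ) : Measurable (birkhoffMax τ h N) := by
  induction N with
  | zero => exact measurable_const
  | succ N ih => exact measurable_const.max (hh.add (ih.comp hτ))

/-- **Maximal ergodic theorem.** -/
theorem setIntegral_birkhoffMax_pos_nonneg {τ : Ω → Ω} (hτ : MeasurePreserving τ μ μ) {h : Ω → ℝ}
    (hm : Measurable h) (hh : Integrable h μ) (N : ℕ) :
    0 ≤ ∫ ω in {ω | 0 < birkhoffMax τ h N ω}, h ω ∂μ := by
  set P := birkhoffMax τ h N with hP
  have hA : MeasurableSet {ω | 0 < P ω} :=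
    measurableSet_lt measurable_const (measurable_birkhoffMax hτ.measurable hm N)
  have hPi : Integrable P μ := integrable_birkhoffMax hτ hh N
  have hPτ : Integrable (fun ω => P (τ ω)) μ := hτ.integrable_comp_of_integrable hPi
  have hint : ∫ ω, P (τ ω) ∂μ = ∫ ω, P ω ∂μ := by
    conv_rhs => rw [← hτ.map_eq]
    exact (integral_map hτ.aemeasurable (by rw [hτ.map_eq]; exact hPi.1)).symm
  -- Garsia's argument: where `P > 0` the recursion reads `P = h + P' ∘ τ`, with `P' ≤ P` the
  -- maximum one step earlier; elsewhere `P = 0 ≤ P ∘ τ`. By invariance the left side has integral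
  -- zero.
  have hle : ∀ ω, P ω - P (τ ω) ≤ indicator {ω | 0 < P ω} h ω := by
    intro ω
    by_cases hω : 0 < P ω
    · rw [indicator_of_mem (show ω ∈ {ω | 0 < P ω} from hω)]
      rcases N with _ | N
      · exact absurd hω (lt_irrefl _)
      · have h1 : P ω = max 0 (h ω + birkhoffMax τ h N (τ ω)) := rfl
        have h2 := birkhoffMax_le_succ τ h N (τ ω)
        rcases max_choice 0 (h ω + birkhoffMax τ h N (τ ω)) with h0 | h0
        · rw [h1, h0] at hω; exact absurd hω (lt_irrefl _)
        · rw [h1, h0]; linarith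
    · rw [indicator_of_notMem (show ω ∉ {ω | 0 < P ω} from hω)]
      have := birkhoffMax_nonneg τ h N (τ ω)
      rw [← hP] at this
      linarith
  rw [← integral_indicator hA]
  calc (0 : ℝ) = ∫ ω, (P ω - P (τ ω)) ∂μ := by rw [integral_sub hPi hPτ, hint, sub_self]
    _ ≤ _ := integral_mono (hPi.sub hPτ) (hh.indicator hA) hle

/-- An average of `v` exceeds `t` exactly when the corresponding Birkhoff sum of `v - t` is
positive, so this is the maximal ergodic theorem for `v - t`, which is integrable because `μ` is
finite. -/
theorem weakMaximal_iSup_birkhoffAverage [IsFiniteMeasure μ] {τ : Ω → Ω}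
    (hτ : MeasurePreserving τ μ μ) {v : Ω → ℝ} (hm : Measurable v) (hv : Integrable v μ)
    (hv0 : 0 ≤ v) :
    WeakMaximal μ (fun ω => ENNReal.ofReal (v ω))
      fun ω => ⨆ n : ℕ, ENNReal.ofReal (birkhoffAverage ℝ τ v (n + 1) ω) := by
  intro t ht
  have hsum (n : ℕ) (ω : Ω) :
      birkhoffSum τ (fun ω => v ω - t) n ω = birkhoffSum τ v n ω - n * t := by
    simp [birkhoffSum]
  have hset : {ω | ENNReal.ofReal t < ⨆ n : ℕ, ENNReal.ofReal (birkhoffAverage ℝ τ v (n + 1) ω)} =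
      ⋃ N : ℕ, {ω | 0 < birkhoffMax τ (fun ω => v ω - t) N ω} := by
    ext ω
    have havg (n : ℕ) : ENNReal.ofReal t < ENNReal.ofReal (birkhoffAverage ℝ τ v (n + 1) ω) ↔
        0 < birkhoffSum τ (fun ω => v ω - t) (n + 1) ω := by
      rw [ENNReal.ofReal_lt_ofReal_iff_of_nonneg ht.le, birkhoffAverage, smul_eq_mul,
        lt_inv_mul_iff₀ (by positivity), hsum, sub_pos]
    simp only [lt_iSup_iff, mem_ofPred_eq, mem_iUnion, havg]
    constructor
    · rintro ⟨n, hn⟩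
      exact ⟨n + 1, hn.trans_le (birkhoffSum_le_birkhoffMax _ _ _ _)⟩
    · rintro ⟨N, hN⟩
      obtain ⟨n, hn⟩ := exists_birkhoffMax_eq τ (fun ω => v ω - t) N ω
      rcases n with _ | n
      · rw [hn, birkhoffSum_zero] at hN; exact absurd hN (lt_irrefl _)
      · exact ⟨n, hn ▸ hN⟩
  rw [hset]
  refine mul_measure_iUnion_le_setLIntegral (monotone_nat_of_le_succ fun N ω hω =>
    lt_of_lt_of_le hω (birkhoffMax_le_succ _ _ _ _)) fun N => ?_
  have h := setIntegral_birkhoffMax_pos_nonneg hτ (hm.sub_const t)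
    (hv.sub (integrable_const t)) N
  rw [integral_sub hv.integrableOn (integrable_const t).integrableOn, setIntegral_const,
    smul_eq_mul, sub_nonneg] at h
  rw [← ofReal_integral_eq_lintegral_ofReal hv.integrableOn (ae_of_all _ hv0),
    ← ofReal_measureReal, ← ENNReal.ofReal_mul ht.le, mul_comm]
  exact ENNReal.ofReal_le_ofReal h

/-! ### Consequences of the maximal inequality of weak type -/

/-- Tonelli. It turns a weak-type inequality, weighted by `w` and integrated over `t`, into a strong
one. Negative `t` also count, since `ENNReal.ofReal t = 0` there, so the weights used below are cut
off by an indicator. -/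
theorem lintegral_mul_setLIntegral_lt_comm [SFinite μ] {v M : Ω → ℝ≥0∞} (hv : Measurable v)
    (hM : Measurable M) {w : ℝ → ℝ≥0∞} (hw : Measurable w) :
    ∫⁻ t, w t * ∫⁻ ω in {ω | ENNReal.ofReal t < M ω}, v ω ∂μ =
      ∫⁻ ω, v ω * (∫⁻ t in {t | ENNReal.ofReal t < M ω}, w t) ∂μ := by
  have hS : MeasurableSet {q : ℝ × Ω | ENNReal.ofReal q.1 < M q.2} :=
    measurableSet_lt (by fun_prop) (by fun_prop)
  have h1 (t : ℝ) : MeasurableSet {ω | ENNReal.ofReal t < M ω} :=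
    measurableSet_lt (by fun_prop) hM
  have h2 (ω : Ω) : MeasurableSet {t : ℝ | ENNReal.ofReal t < M ω} :=
    measurableSet_lt (by fun_prop) (by fun_prop)
  have hmeas : Measurable fun q : ℝ × Ω =>
      {q : ℝ × Ω | ENNReal.ofReal q.1 < M q.2}.indicator (fun q => w q.1 * v q.2) q :=
    Measurable.indicator (by fun_prop) hS
  calc ∫⁻ t, w t * ∫⁻ ω in {ω | ENNReal.ofReal t < M ω}, v ω ∂μ
      = ∫⁻ t, ∫⁻ ω, {q : ℝ × Ω | ENNReal.ofReal q.1 < M q.2}.indicator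
          (fun q => w q.1 * v q.2) (t, ω) ∂μ := by
        refine lintegral_congr fun t => ?_
        rw [← lintegral_const_mul _ hv, ← lintegral_indicator (h1 t)]
        rfl
    _ = ∫⁻ ω, (∫⁻ t, {q : ℝ × Ω | ENNReal.ofReal q.1 < M q.2}.indicator
          (fun q => w q.1 * v q.2) (t, ω)) ∂μ := lintegral_lintegral_swap hmeas.aemeasurable
    _ = _ := by
        refine lintegral_congr fun ω => ?_
        rw [← lintegral_const_mul _ hw, ← lintegral_indicator (h2 ω)]
        refine lintegral_congr fun t => ?_
        simp only [indicator, mem_ofPred_eq]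
        rw [mul_comm]

theorem setLIntegral_ofReal_rpow_sub_one {q : ℝ} (hq : 0 < q) {a : ℝ≥0∞} (ha : a ≠ ∞) :
    ∫⁻ t in {t | ENNReal.ofReal t < a}, (Ioi 0).indicator (fun t => ENNReal.ofReal (t ^ (q - 1))) t
      = ENNReal.ofReal q⁻¹ * a ^ q := by
  lift a to NNReal using ha
  have hset : Ioi 0 ∩ {t : ℝ | ENNReal.ofReal t < a} = Ioo 0 (a : ℝ) := by
    ext t
    simp only [mem_inter_iff, mem_Ioi, mem_ofPred_eq, mem_Ioo, and_congr_right_iff]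
    intro ht
    rw [ENNReal.ofReal_lt_coe_iff ht.le]
  rw [setLIntegral_indicator measurableSet_Ioi, hset, restrict_Ioo_eq_restrict_Ioc,
    ← ofReal_integral_eq_lintegral_ofReal, ← intervalIntegral.integral_of_le a.coe_nonneg,
    integral_rpow (Or.inl (by linarith))]
  · have : (a : ℝ≥0∞) ^ q = ENNReal.ofReal ((a : ℝ) ^ q) := by
      rw [← ENNReal.ofReal_rpow_of_nonneg a.coe_nonneg hq.le, ENNReal.ofReal_coe_nnreal]
    rw [this, ← ENNReal.ofReal_mul (by positivity)]
    simp [Real.zero_rpow hq.ne', div_eq_inv_mul]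
  · exact (intervalIntegrable_iff_integrableOn_Ioc_of_le a.coe_nonneg).1
      (intervalIntegral.intervalIntegrable_rpow' (by linarith))
  · filter_upwards [ae_restrict_mem measurableSet_Ioc] with t ht
    exact Real.rpow_nonneg ht.1.le _

theorem WeakMaximal.min_const {u M : Ω → ℝ≥0∞} (h : WeakMaximal μ u M) (K : ℝ≥0∞) :
    WeakMaximal μ u fun ω => min (M ω) K := by
  intro t ht
  by_cases hK : ENNReal.ofReal t < K
  · simpa [hK] using h t ht
  · simp [hK]

/-- Integrating the weak inequality against `t ^ (p - 2)` gives `p⁻¹ ∫ M^p ≤ (p - 1)⁻¹ ∫ u M^(p-1)`.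
Hölder bounds the right side, and a power of `∫ M^p` is cancelled; boundedness of `M` makes it
finite. -/
theorem WeakMaximal.lintegral_rpow_le_of_bounded [IsFiniteMeasure μ] {u M : Ω → ℝ≥0∞}
    (hu : Measurable u) (hM : Measurable M) (h : WeakMaximal μ u M) {K : ℝ≥0∞} (hK : K ≠ ∞)
    (hMK : ∀ ω, M ω ≤ K) {p : ℝ} (hp : 1 < p) :
    (∫⁻ ω, M ω ^ p ∂μ) ^ (1 / p) ≤
      ENNReal.ofReal (p / (p - 1)) * (∫⁻ ω, u ω ^ p ∂μ) ^ (1 / p) := by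
  have hp0 : 0 < p := by linarith
  have hp1 : 0 < p - 1 := by linarith
  have hMtop (ω : Ω) : M ω ≠ ∞ := ne_top_of_le_ne_top hK (hMK ω)
  have hmeas (q : ℝ) :
      Measurable ((Ioi (0 : ℝ)).indicator fun t => ENNReal.ofReal (t ^ (q - 1))) :=
    Measurable.indicator (by fun_prop) measurableSet_Ioi
  have hpq : p.HolderConjugate (p / (p - 1)) := Real.HolderConjugate.conjExponent hp
  have hfin : ∫⁻ ω, M ω ^ p ∂μ ≠ ∞ := by
    refine ne_top_of_le_ne_top (b := ∫⁻ _, K ^ p ∂μ) ?_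
      (lintegral_mono fun ω => ENNReal.rpow_le_rpow (hMK ω) hp0.le)
    rw [lintegral_const]
    exact ENNReal.mul_ne_top (ENNReal.rpow_ne_top_of_nonneg hp0.le hK) (measure_ne_top _ _)
  have hlayer : ENNReal.ofReal p⁻¹ * ∫⁻ ω, M ω ^ p ∂μ ≤
      ENNReal.ofReal (p - 1)⁻¹ * ∫⁻ ω, u ω * M ω ^ (p - 1) ∂μ := by
    calc ENNReal.ofReal p⁻¹ * ∫⁻ ω, M ω ^ p ∂μ
        = ∫⁻ ω, 1 * (∫⁻ t in {t | ENNReal.ofReal t < M ω},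
            (Ioi 0).indicator (fun t => ENNReal.ofReal (t ^ (p - 1))) t) ∂μ := by
          rw [← lintegral_const_mul _ (by fun_prop)]
          exact lintegral_congr fun ω => by
            rw [setLIntegral_ofReal_rpow_sub_one hp0 (hMtop ω), one_mul]
      _ = ∫⁻ t, (Ioi 0).indicator (fun t => ENNReal.ofReal (t ^ (p - 1))) t *
            ∫⁻ ω in {ω | ENNReal.ofReal t < M ω}, 1 ∂μ :=
          (lintegral_mul_setLIntegral_lt_comm measurable_const hM (hmeas p)).symm
      _ ≤ ∫⁻ t, (Ioi 0).indicator (fun t => ENNReal.ofReal (t ^ (p - 1 - 1))) t *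
            ∫⁻ ω in {ω | ENNReal.ofReal t < M ω}, u ω ∂μ := by
          refine lintegral_mono fun t => ?_
          by_cases ht : t ∈ Ioi (0 : ℝ)
          · simp only [indicator_of_mem ht, setLIntegral_one]
            have ht' : 0 < t := ht
            have hsplit : t ^ (p - 1) = t ^ (p - 1 - 1) * t := by
              rw [Real.rpow_sub_one ht'.ne' (p - 1), div_mul_cancel₀ _ ht'.ne']
            rw [hsplit, ENNReal.ofReal_mul (Real.rpow_nonneg ht'.le _), mul_assoc]
            gcongr
            exact h t ht'
          · simp [indicator_of_notMem ht]
      _ = ∫⁻ ω, u ω * (∫⁻ t in {t | ENNReal.ofReal t < M ω},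
            (Ioi 0).indicator (fun t => ENNReal.ofReal (t ^ (p - 1 - 1))) t) ∂μ :=
          lintegral_mul_setLIntegral_lt_comm hu hM (hmeas (p - 1))
      _ = ENNReal.ofReal (p - 1)⁻¹ * ∫⁻ ω, u ω * M ω ^ (p - 1) ∂μ := by
          rw [← lintegral_const_mul _ (by fun_prop)]
          exact lintegral_congr fun ω => by
            rw [setLIntegral_ofReal_rpow_sub_one hp1 (hMtop ω), mul_left_comm]
  have hholder := ENNReal.lintegral_mul_le_Lp_mul_Lq μ hpq hu.aemeasurable
    (g := fun ω => M ω ^ (p - 1)) (by fun_prop)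
  have hexp : ∫⁻ ω, (M ω ^ (p - 1)) ^ (p / (p - 1)) ∂μ = ∫⁻ ω, M ω ^ p ∂μ :=
    lintegral_congr fun ω => by rw [← ENNReal.rpow_mul, mul_div_cancel₀ _ hp1.ne']
  simp only [Pi.mul_apply, hexp] at hholder
  set I := ∫⁻ ω, M ω ^ p ∂μ with hI
  set B := (∫⁻ ω, u ω ^ p ∂μ) ^ (1 / p)
  have hmain : I ≤ ENNReal.ofReal (p / (p - 1)) * B * I ^ (1 / (p / (p - 1))) := by
    calc I = ENNReal.ofReal p * (ENNReal.ofReal p⁻¹ * I) := by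
          rw [← mul_assoc, ← ENNReal.ofReal_mul hp0.le, mul_inv_cancel₀ hp0.ne', ENNReal.ofReal_one,
            one_mul]
      _ ≤ ENNReal.ofReal p * (ENNReal.ofReal (p - 1)⁻¹ * (B * I ^ (1 / (p / (p - 1))))) := by
          exact mul_le_mul' le_rfl (hlayer.trans (mul_le_mul' le_rfl hholder))
      _ = _ := by
          rw [← mul_assoc, ← ENNReal.ofReal_mul hp0.le, div_eq_mul_inv p (p - 1), mul_assoc]
  rcases eq_or_ne I 0 with hI0 | hI0
  · rw [hI0, ENNReal.zero_rpow_of_pos (by positivity)]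
    exact zero_le
  · have hsplit : I = I ^ (1 / p) * I ^ (1 / (p / (p - 1))) := by
      rw [← ENNReal.rpow_add _ _ hI0 hfin]
      have : 1 / p + 1 / (p / (p - 1)) = 1 := by field_simp; ring
      rw [this, ENNReal.rpow_one]
    have hne0 : I ^ (1 / (p / (p - 1))) ≠ 0 := by simp [ENNReal.rpow_eq_zero_iff, hI0, hfin]
    have hnet : I ^ (1 / (p / (p - 1))) ≠ ∞ :=
      ENNReal.rpow_ne_top_of_nonneg (by positivity) hfin
    refine (ENNReal.mul_le_mul_iff_left hne0 hnet).1 ?_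
    rw [← hsplit]
    exact hmain

/-- Truncations `min M K` inherit the weak inequality; monotone convergence removes `K`. -/
theorem WeakMaximal.lintegral_rpow_le [IsFiniteMeasure μ] {u M : Ω → ℝ≥0∞}
    (hu : Measurable u) (hM : Measurable M) (h : WeakMaximal μ u M) {p : ℝ} (hp : 1 < p) :
    (∫⁻ ω, M ω ^ p ∂μ) ^ (1 / p) ≤
      ENNReal.ofReal (p / (p - 1)) * (∫⁻ ω, u ω ^ p ∂μ) ^ (1 / p) := by
  have hp0 : 0 < p := by linarith
  have hsup (ω : Ω) : M ω ^ p = ⨆ K : ℕ, min (M ω) K ^ p := by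
    have h1 : M ω = ⨆ K : ℕ, min (M ω) K := by
      rw [← inf_iSup_eq, ENNReal.iSup_natCast, inf_top_eq]
    conv_lhs => rw [h1]
    exact (ENNReal.orderIsoRpow p hp0).map_iSup _
  have hmono : Monotone fun (K : ℕ) ω => min (M ω) K ^ p := by
    intro K K' hK ω
    exact ENNReal.rpow_le_rpow (min_le_min le_rfl (by exact_mod_cast hK)) hp0.le
  simp_rw [hsup]
  rw [lintegral_iSup (fun K => by fun_prop) hmono]
  rw [show (⨆ K : ℕ, ∫⁻ ω, min (M ω) K ^ p ∂μ) ^ (1 / p) =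
    ⨆ K : ℕ, (∫⁻ ω, min (M ω) K ^ p ∂μ) ^ (1 / p) from
    (ENNReal.orderIsoRpow (1 / p) (by positivity)).map_iSup _]
  exact iSup_le fun K => (h.min_const K).lintegral_rpow_le_of_bounded hu (by fun_prop)
    (ENNReal.natCast_ne_top K) (fun ω => min_le_right _ _) hp

/-! ### The logarithmic classes -/

/-- The function `t ↦ t (log max (1, t))^m` on `[0, ∞]`. -/
noncomputable def lLogL (m : ℝ) (x : ℝ≥0∞) : ℝ≥0∞ := x * (ENNReal.log (max 1 x)).toENNReal ^ m

theorem lLogL_mono {m : ℝ} (hm : 0 ≤ m) : Monotone (lLogL m) := by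
  intro x y hxy
  unfold lLogL
  gcongr
  exact EReal.toENNReal_le_toENNReal (ENNReal.log_monotone (max_le_max le_rfl hxy))

theorem toENNReal_log_max_one_ofReal {x : ℝ} (hx : 1 ≤ x) :
    (ENNReal.log (max 1 (ENNReal.ofReal x))).toENNReal = ENNReal.ofReal (Real.log x) := by
  rw [max_eq_right (by simpa using hx), ENNReal.log_ofReal_of_pos (by linarith)]
  simp [EReal.toENNReal]

theorem lLogL_ofReal {m x : ℝ} (hm : 0 ≤ m) (hx : 1 ≤ x) :
    lLogL m (ENNReal.ofReal x) = ENNReal.ofReal (x * Real.log x ^ m) := by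
  rw [lLogL, toENNReal_log_max_one_ofReal hx,
    ENNReal.ofReal_rpow_of_nonneg (Real.log_nonneg hx) hm, ENNReal.ofReal_mul (by linarith)]

theorem lLogL_top {m : ℝ} (hm : 0 ≤ m) : lLogL m ∞ = ∞ := by
  rcases hm.eq_or_lt with rfl | hm
  · simp [lLogL]
  · simp [lLogL, ENNReal.top_rpow_of_pos hm]

theorem setLIntegral_indicator_Ioi_lt_ofReal {a b : ℝ} (ha : 0 ≤ a) (w : ℝ → ℝ≥0∞) :
    ∫⁻ t in {t | ENNReal.ofReal t < ENNReal.ofReal b}, (Ioi a).indicator w t =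
      ∫⁻ t in Ioo a b, w t := by
  have hset : Ioi a ∩ {t : ℝ | ENNReal.ofReal t < ENNReal.ofReal b} = Ioo a b := by
    ext t
    simp only [mem_inter_iff, mem_Ioi, mem_ofPred_eq, mem_Ioo, and_congr_right_iff]
    intro ht
    rw [ENNReal.ofReal_lt_ofReal_iff_of_nonneg (ha.trans ht.le)]
  rw [setLIntegral_indicator measurableSet_Ioi, hset]

/-- The integral over `(x/4, x/2)` alone is at least `(x/4) log^m (x/4)`, and `log x ≤ 2 log (x/4)`
once `x ≥ 16`, because then `x ≤ (x/4)^2`. Smaller `x` go into the constant. The level `x / 2`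
matches `WeakMaximal.mul_measure_lt_half_le`. -/
theorem lLogL_le_add_lintegral {m : ℝ} (hm : 0 ≤ m) (x : ℝ≥0∞) :
    lLogL m x ≤ ENNReal.ofReal (16 * Real.log 16 ^ m) + ENNReal.ofReal (4 * 2 ^ m) *
      ∫⁻ t in {t | ENNReal.ofReal t < x / 2},
        (Ioi 1).indicator (fun t => ENNReal.ofReal (Real.log t ^ m)) t := by
  rcases eq_or_ne x ∞ with rfl | hx
  · have hinf : ∫⁻ t in {t | ENNReal.ofReal t < ∞ / 2},
        (Ioi 1).indicator (fun t => ENNReal.ofReal (Real.log t ^ m)) t = ∞ := by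
      have htop : (∞ : ℝ≥0∞) / 2 = ∞ := ENNReal.top_div_of_ne_top (by simp)
      have hset : {t : ℝ | ENNReal.ofReal t < ∞ / 2} = univ := by simp [htop]
      rw [hset, Measure.restrict_univ, lintegral_indicator measurableSet_Ioi, ← top_le_iff]
      -- Beyond `e` the integrand is at least `1`, so the integral diverges.
      have hexp : (1 : ℝ) < Real.exp 1 := by simp
      calc (∞ : ℝ≥0∞) = ∫⁻ t in Ioi (Real.exp 1), 1 := by simp
        _ ≤ ∫⁻ t in Ioi (Real.exp 1), ENNReal.ofReal (Real.log t ^ m) := by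
          refine setLIntegral_mono' measurableSet_Ioi fun t ht => ?_
          rw [ENNReal.one_le_ofReal]
          refine Real.one_le_rpow ?_ hm
          rw [Real.le_log_iff_exp_le (by linarith [show Real.exp 1 < t from ht])]
          exact (show Real.exp 1 < t from ht).le
        _ ≤ _ := lintegral_mono_set (Ioi_subset_Ioi hexp.le)
    rw [hinf, ENNReal.mul_top (by simp; positivity), add_top]
    exact le_top
  · obtain ⟨a, ha, rfl⟩ : ∃ a : ℝ, 0 ≤ a ∧ ENNReal.ofReal a = x :=
      ⟨x.toReal, ENNReal.toReal_nonneg, ENNReal.ofReal_toReal hx⟩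
    rcases le_total a 16 with h16 | h16
    · refine le_add_right ?_
      rw [← lLogL_ofReal hm (by norm_num)]
      exact lLogL_mono hm (ENNReal.ofReal_le_ofReal h16)
    · refine le_add_left ?_
      have hhalf : ENNReal.ofReal a / 2 = ENNReal.ofReal (a / 2) := by
        rw [ENNReal.ofReal_div_of_pos two_pos]; simp
      have hlog : Real.log a ≤ 2 * Real.log (a / 4) := by
        rw [← Real.log_rpow (by positivity)]
        refine Real.log_le_log (by linarith) ?_
        norm_num
        nlinarith
      have hlog0 : 0 ≤ Real.log (a / 4) := Real.log_nonneg (by linarith)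
      rw [hhalf, setLIntegral_indicator_Ioi_lt_ofReal zero_le_one, lLogL_ofReal hm (by linarith)]
      calc ENNReal.ofReal (a * Real.log a ^ m)
          ≤ ENNReal.ofReal (4 * 2 ^ m * (Real.log (a / 4) ^ m * (a / 2 - a / 4))) := by
            refine ENNReal.ofReal_le_ofReal ?_
            have := Real.rpow_le_rpow (Real.log_nonneg (by linarith)) hlog hm
            rw [Real.mul_rpow two_pos.le hlog0] at this
            nlinarith
        _ = ENNReal.ofReal (4 * 2 ^ m) *
              ∫⁻ t in Ioo (a / 4) (a / 2), ENNReal.ofReal (Real.log (a / 4) ^ m) := by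
            rw [ENNReal.ofReal_mul (by positivity), setLIntegral_const, Real.volume_Ioo,
              ENNReal.ofReal_mul (Real.rpow_nonneg hlog0 m)]
        _ ≤ ENNReal.ofReal (4 * 2 ^ m) *
              ∫⁻ t in Ioo (a / 4) (a / 2), ENNReal.ofReal (Real.log t ^ m) := by
            refine mul_le_mul' le_rfl (setLIntegral_mono' measurableSet_Ioo fun t ht => ?_)
            have := ht.1
            gcongr
        _ ≤ _ := mul_le_mul' le_rfl
            (lintegral_mono_set (Ioo_subset_Ioo_left (by linarith)))

/-- On `1 < t < x` one has `log t ≤ log x`, and `∫ dt/t = log x` supplies the extra logarithm. -/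
theorem mul_lintegral_rpow_log_div_le {m : ℝ} (hm : 0 ≤ m) (x : ℝ≥0∞) :
    x * ∫⁻ t in {t | ENNReal.ofReal t < x},
        (Ioi 1).indicator (fun t => ENNReal.ofReal (Real.log t ^ m * t⁻¹)) t ≤
      lLogL (m + 1) x := by
  rcases eq_or_ne x ∞ with rfl | hx
  · rw [lLogL_top (by linarith)]
    exact le_top
  · obtain ⟨a, ha, rfl⟩ : ∃ a : ℝ, 0 ≤ a ∧ ENNReal.ofReal a = x :=
      ⟨x.toReal, ENNReal.toReal_nonneg, ENNReal.ofReal_toReal hx⟩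
    rw [setLIntegral_indicator_Ioi_lt_ofReal zero_le_one]
    rcases le_total a 1 with h1 | h1
    · simp [Ioo_eq_empty_of_le h1]
    · have hlog0 : 0 ≤ Real.log a := Real.log_nonneg h1
      have hint : ∫⁻ t in Ioo 1 a, ENNReal.ofReal t⁻¹ = ENNReal.ofReal (Real.log a) := by
        rw [restrict_Ioo_eq_restrict_Ioc, ← ofReal_integral_eq_lintegral_ofReal,
          ← intervalIntegral.integral_of_le h1, integral_inv_of_pos one_pos (by linarith), div_one]
        · refine (intervalIntegrable_iff_integrableOn_Ioc_of_le h1).1 ?_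
          refine intervalIntegral.intervalIntegrable_inv (fun t ht => ?_) continuousOn_id
          rw [uIcc_of_le h1] at ht
          exact (zero_lt_one.trans_le ht.1).ne'
        · filter_upwards [ae_restrict_mem measurableSet_Ioc] with t ht
          exact inv_nonneg.2 (zero_lt_one.trans ht.1).le
      rw [lLogL, toENNReal_log_max_one_ofReal h1, ENNReal.rpow_add_of_nonneg _ _ hm zero_le_one,
        ENNReal.rpow_one]
      refine mul_le_mul' le_rfl ?_
      rw [ENNReal.ofReal_rpow_of_nonneg hlog0 hm, ← hint, ← lintegral_const_mul _ (by fun_prop)]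
      refine setLIntegral_mono' measurableSet_Ioo fun t ht => ?_
      have h0 : 0 ≤ Real.log t := Real.log_nonneg ht.1.le
      have h2 := ht.2.le
      have h3 : 0 < t := zero_lt_one.trans ht.1
      rw [← ENNReal.ofReal_mul (by positivity)]
      gcongr

/-- Apply the weak inequality at level `2t` and bound `u` by `u 1_{u > t} + t`; the finite term `t
μ{M > 2t}` is then subtracted. The right side no longer involves `M`. -/
theorem WeakMaximal.mul_measure_lt_half_le [IsFiniteMeasure μ] {u M : Ω → ℝ≥0∞}
    (hu : Measurable u) (h : WeakMaximal μ u M) {t : ℝ} (ht : 0 < t) :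
    ENNReal.ofReal t * μ {ω | ENNReal.ofReal t < M ω / 2} ≤
      ∫⁻ ω in {ω | ENNReal.ofReal t < u ω}, u ω ∂μ := by
  have hset : {ω | ENNReal.ofReal t < M ω / 2} = {ω | ENNReal.ofReal (2 * t) < M ω} := by
    ext ω
    rw [mem_ofPred_eq, mem_ofPred_eq, ENNReal.lt_div_iff_mul_lt (by simp) (by simp), mul_comm 2 t,
      ENNReal.ofReal_mul ht.le, ENNReal.ofReal_ofNat]
  rw [hset]
  set A := {ω | ENNReal.ofReal (2 * t) < M ω}
  have hB : MeasurableSet {ω | ENNReal.ofReal t < u ω} := measurableSet_lt measurable_const hu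
  have hfin : ENNReal.ofReal t * μ A ≠ ∞ :=
    ENNReal.mul_ne_top ENNReal.ofReal_ne_top (measure_ne_top _ _)
  refine (ENNReal.add_le_add_iff_right hfin).1 ?_
  calc ENNReal.ofReal t * μ A + ENNReal.ofReal t * μ A
      = ENNReal.ofReal (2 * t) * μ A := by
        rw [two_mul, ENNReal.ofReal_add ht.le ht.le, add_mul]
    _ ≤ ∫⁻ ω in A, u ω ∂μ := h (2 * t) (by linarith)
    _ ≤ ∫⁻ ω in A, {ω | ENNReal.ofReal t < u ω}.indicator u ω + ENNReal.ofReal t ∂μ := by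
        refine lintegral_mono fun ω => ?_
        by_cases hω : ENNReal.ofReal t < u ω
        · rw [indicator_of_mem (show ω ∈ {ω | ENNReal.ofReal t < u ω} from hω)]
          exact le_self_add
        · exact (not_lt.1 hω).trans le_add_self
    _ = ∫⁻ ω in A, {ω | ENNReal.ofReal t < u ω}.indicator u ω ∂μ + ENNReal.ofReal t * μ A := by
        rw [lintegral_add_right _ measurable_const, setLIntegral_const]
    _ ≤ _ := by
        rw [← lintegral_indicator hB]
        exact add_le_add (setLIntegral_le_lintegral _ _) le_rfl

/-- Integrate the preceding inequality against `t⁻¹ log^m t` over `t > 1`: the left side controls `∫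
M log^m M` up to constants, and the right side is at most `∫ u log^(m+1) u`. -/
theorem WeakMaximal.lintegral_lLogL_lt_top [IsFiniteMeasure μ] {u M : Ω → ℝ≥0∞}
    (hu : Measurable u) (hM : Measurable M) (h : WeakMaximal μ u M) {m : ℝ} (hm : 0 ≤ m)
    (hum : ∫⁻ ω, lLogL (m + 1) (u ω) ∂μ < ∞) : ∫⁻ ω, lLogL m (M ω) ∂μ < ∞ := by
  have hw : Measurable ((Ioi 1).indicator fun t => ENNReal.ofReal (Real.log t ^ m)) :=
    Measurable.indicator (by fun_prop) measurableSet_Ioi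
  have hw' : Measurable ((Ioi 1).indicator fun t => ENNReal.ofReal (Real.log t ^ m * t⁻¹)) :=
    Measurable.indicator (by fun_prop) measurableSet_Ioi
  have hle : ∫⁻ ω, 1 * (∫⁻ t in {t | ENNReal.ofReal t < M ω / 2},
      (Ioi 1).indicator (fun t => ENNReal.ofReal (Real.log t ^ m)) t) ∂μ ≤
        ∫⁻ ω, lLogL (m + 1) (u ω) ∂μ := by
    rw [← lintegral_mul_setLIntegral_lt_comm measurable_const (hM.div_const 2) hw]
    refine le_trans ?_ (lintegral_mono fun ω => mul_lintegral_rpow_log_div_le hm (u ω))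
    rw [← lintegral_mul_setLIntegral_lt_comm hu hu hw']
    refine lintegral_mono fun t => ?_
    by_cases ht : t ∈ Ioi (1 : ℝ)
    · have ht1 : 1 < t := ht
      have ht0 : 0 < t := zero_lt_one.trans ht1
      have hsplit : Real.log t ^ m = Real.log t ^ m * t⁻¹ * t := by
        rw [mul_assoc, inv_mul_cancel₀ ht0.ne', mul_one]
      have hpos : 0 ≤ Real.log t ^ m * t⁻¹ :=
        mul_nonneg (Real.rpow_nonneg (Real.log_nonneg ht1.le) _) (inv_nonneg.2 ht0.le)
      simp only [indicator_of_mem ht, setLIntegral_one]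
      conv_lhs => rw [hsplit, ENNReal.ofReal_mul hpos, mul_assoc]
      exact mul_le_mul' le_rfl (h.mul_measure_lt_half_le hu ht0)
    · simp [indicator_of_notMem ht]
  simp only [one_mul] at hle
  refine (lintegral_mono fun ω => lLogL_le_add_lintegral hm (M ω)).trans_lt ?_
  rw [lintegral_add_left measurable_const, lintegral_const,
    lintegral_const_mul' _ _ ENNReal.ofReal_ne_top]
  exact ENNReal.add_lt_top.2 ⟨ENNReal.mul_lt_top ENNReal.ofReal_lt_top (measure_lt_top _ _),
    ENNReal.mul_lt_top ENNReal.ofReal_lt_top (hle.trans_lt hum)⟩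

/-! ### The martingale-ergodic maximal function -/

theorem enorm_condExp_le_condLExp {X : Type*} [NormedAddCommGroup X] [NormedSpace ℝ X]
    [CompleteSpace X] (m : MeasurableSpace Ω) (h : Ω → X) :
    ∀ᵐ ω ∂μ, ‖(μ[h|m]) ω‖ₑ ≤ (μ⁻[fun ω => ‖h ω‖ₑ|m]) ω := by
  by_cases hh : Integrable h μ
  · have h1 := condLExp_ofReal m hh.norm (ae_of_all _ fun ω => norm_nonneg (h ω))
    simp only [ofReal_norm] at h1
    filter_upwards [h1, norm_condExp_le (m := m) (μ := μ) h] with ω h1 h2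
    rw [h1, ← ofReal_norm]
    exact ENNReal.ofReal_le_ofReal h2
  -- `condExp` of a non-integrable function is zero by convention.
  · refine ae_of_all _ fun ω => ?_
    simp [condExp_of_not_integrable hh]

/-- The martingale-ergodic maximal function is dominated by the composition of two maximal functions
that satisfy inequalities of weak type. -/
theorem exists_weakMaximal_martingaleErgodicMaximal_le
    {X : Type*} [NormedAddCommGroup X] [NormedSpace ℝ X] [CompleteSpace X] [IsFiniteMeasure μ]
    {τ : Ω → Ω} (hτ : MeasurePreserving τ μ μ)
    {F : ℕ → MeasurableSpace Ω} (hF_le : ∀ n, F n ≤ mΩ) (hF_anti : Antitone F)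
    {f : Ω → X} (hf : Integrable f μ) :
    ∃ u G M : Ω → ℝ≥0∞, Measurable u ∧ Measurable G ∧ Measurable M ∧
      (∀ᵐ ω ∂μ, u ω = ‖f ω‖ₑ) ∧ WeakMaximal μ u G ∧ WeakMaximal μ G M ∧
      ∀ᵐ ω ∂μ, martingaleErgodicMaximal μ F (koopman X τ) f ω ≤ M ω := by
  set g := hf.1.mk f
  have hfg : f =ᵐ[μ] g := hf.1.ae_eq_mk
  have hg : StronglyMeasurable g := hf.1.stronglyMeasurable_mk
  set v : Ω → ℝ := fun ω => ‖g ω‖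
  have hv : Measurable v := hg.norm.measurable
  have hvi : Integrable v μ := (hf.congr hfg).norm
  set G : Ω → ℝ≥0∞ := fun ω => ⨆ n : ℕ, ENNReal.ofReal (birkhoffAverage ℝ τ v (n + 1) ω)
  have hG : Measurable G := by
    refine Measurable.iSup fun n => ENNReal.measurable_ofReal.comp ?_
    exact (Finset.measurable_sum _ fun i _ =>
      hv.comp (hτ.measurable.iterate i)).const_smul (((n + 1 : ℕ) : ℝ)⁻¹)
  refine ⟨fun ω => ENNReal.ofReal (v ω), G, fun ω => ⨆ k, (μ⁻[G|F k]) ω,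
    hv.ennreal_ofReal, hG, Measurable.iSup fun k => measurable_condLExp' _ _ _, ?_,
    weakMaximal_iSup_birkhoffAverage hτ hv hvi fun ω => norm_nonneg _,
    weakMaximal_iSup_condLExp hF_le hF_anti G, ?_⟩
  · filter_upwards [hfg] with ω hω
    rw [hω, ofReal_norm]
  -- Iterates of `τ` pull null sets back to null sets, so almost every orbit avoids the set where
  -- `f` differs from its representative `g`.
  · have horbit : ∀ᵐ ω ∂μ, ∀ i, ‖f (τ^[i] ω)‖ ≤ v (τ^[i] ω) := by
      refine ae_all_iff.2 fun i => ?_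
      filter_upwards [(hτ.iterate i).quasiMeasurePreserving.ae hfg] with ω hω
      exact (congrArg norm hω).le
    have hle (n k : ℕ) : ∀ᵐ ω ∂μ,
        ‖(μ[ergodicAverage (koopman X τ) (n + 1) f|F k]) ω‖ₑ ≤ (μ⁻[G|F k]) ω := by
      have hmono : (fun ω => ‖ergodicAverage (koopman X τ) (n + 1) f ω‖ₑ) ≤ᵐ[μ] G := by
        filter_upwards [horbit] with ω hω
        exact (enorm_ergodicAverage_le hω (n + 1)).trans
          (le_iSup (fun n : ℕ => ENNReal.ofReal (birkhoffAverage ℝ τ v (n + 1) ω)) n)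
      filter_upwards [enorm_condExp_le_condLExp (μ := μ) (F k)
        (ergodicAverage (koopman X τ) (n + 1) f), condLExp_mono (mΩ := F k) hmono] with ω h1 h2
      exact h1.trans h2
    filter_upwards [ae_all_iff.2 fun n => ae_all_iff.2 (hle n)] with ω hω
    exact iSup_le fun n => iSup_le fun k => (hω n k).trans
      (le_iSup (fun k => (μ⁻[G|F k]) ω) k)

theorem measurable_martingaleErgodicMaximal
    {X : Type*} [NormedAddCommGroup X] [NormedSpace ℝ X] [CompleteSpace X]
    {F : ℕ → MeasurableSpace Ω} (hF_le : ∀ n, F n ≤ mΩ) (T : (Ω → X) →ₗ[ℝ] (Ω → X)) (f : Ω → X) :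
    Measurable (martingaleErgodicMaximal μ F T f) :=
  Measurable.iSup fun _ => Measurable.iSup fun k =>
    (stronglyMeasurable_condExp.mono (hF_le k)).enorm

end MartingaleErgodic

/-! ### The dominant inequality -/

theorem theorem2p4
    {X : Type*} [NormedAddCommGroup X] [NormedSpace ℝ X] [CompleteSpace X]
    (hX : MartingaleErgodic.IsReflexiveSpace X)
    {Ω : Type*} [mΩ : MeasurableSpace Ω] (μ : Measure Ω) [IsFiniteMeasure μ]
    (τ : Ω → Ω) (hτ : MeasurePreserving τ μ μ)
    (F : ℕ → MeasurableSpace Ω) (hF_le : ∀ n, F n ≤ mΩ) (hF_anti : Antitone F)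
    (f : Ω → X) (hf : Integrable f μ)
    (hsup : MemLp (MartingaleErgodic.ergodicMaximal (MartingaleErgodic.koopman X τ) f) 1 μ) :
    (∀ p : ℝ, 1 < p →
      eLpNorm (MartingaleErgodic.martingaleErgodicMaximal μ F (MartingaleErgodic.koopman X τ) f)
          (ENNReal.ofReal p) μ
        ≤ ENNReal.ofReal ((p / (p - 1)) ^ 2) * eLpNorm f (ENNReal.ofReal p) μ) ∧
    (∀ m : ℝ, 0 ≤ m → MartingaleErgodic.MemLLogL f (m + 2) μ →
      MartingaleErgodic.MemLLogL
        (MartingaleErgodic.martingaleErgodicMaximal μ F (MartingaleErgodic.koopman X τ) f) m μ) := by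
  obtain ⟨u, G, M, hu, hG, hM, huf, hwG, hwM, hle⟩ :=
    MartingaleErgodic.exists_weakMaximal_martingaleErgodicMaximal_le hτ hF_le hF_anti hf
  refine ⟨fun p hp => ?_, fun m hm hfm => ?_⟩
  · have hp0 : 0 < p := by linarith
    have hp1 : 0 < p - 1 := by linarith
    have hpt : (ENNReal.ofReal p).toReal = p := ENNReal.toReal_ofReal hp0.le
    have hne : ENNReal.ofReal p ≠ 0 := by simpa using hp0
    rw [eLpNorm_eq_lintegral_rpow_enorm_toReal hne ENNReal.ofReal_ne_top,
      eLpNorm_eq_lintegral_rpow_enorm_toReal hne ENNReal.ofReal_ne_top, hpt]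
    simp only [enorm_eq_self]
    calc _ ≤ (∫⁻ ω, M ω ^ p ∂μ) ^ (1 / p) := by
          refine ENNReal.rpow_le_rpow (lintegral_mono_ae ?_) (by positivity)
          filter_upwards [hle] with ω hω
          exact ENNReal.rpow_le_rpow hω hp0.le
      _ ≤ ENNReal.ofReal (p / (p - 1)) * (∫⁻ ω, G ω ^ p ∂μ) ^ (1 / p) :=
          hwM.lintegral_rpow_le hG hM hp
      _ ≤ ENNReal.ofReal (p / (p - 1)) *
            (ENNReal.ofReal (p / (p - 1)) * (∫⁻ ω, u ω ^ p ∂μ) ^ (1 / p)) :=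
          mul_le_mul' le_rfl (hwG.lintegral_rpow_le hu hG hp)
      _ = _ := by
          rw [← mul_assoc, ← ENNReal.ofReal_mul (by positivity), ← sq]
          congr 2
          refine lintegral_congr_ae ?_
          filter_upwards [huf] with ω hω
          rw [hω]
  · refine ⟨(MartingaleErgodic.measurable_martingaleErgodicMaximal hF_le _ f).aestronglyMeasurable,
      ?_⟩
    have hum : ∫⁻ ω, MartingaleErgodic.lLogL (m + 1 + 1) (u ω) ∂μ < ∞ := by
      refine lt_of_le_of_lt (le_of_eq (lintegral_congr_ae ?_)) hfm.2
      filter_upwards [huf] with ω hω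
      rw [hω, MartingaleErgodic.lLogL, show m + 1 + 1 = m + 2 by ring]
    -- The ergodic step lowers the exponent from `m + 2` to `m + 1`, the martingale step from `m +
    -- 1` to `m`.
    refine lt_of_le_of_lt (lintegral_mono_ae ?_) (hwM.lintegral_lLogL_lt_top hG hM hm
      (hwG.lintegral_lLogL_lt_top hu hG (by linarith) hum))
    filter_upwards [hle] with ω hω
    exact MartingaleErgodic.lLogL_mono hm hω
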